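/- For $x\in[0,1]^2$ and $r\in[1,2]$ let $C(x,r)\subset\mathbb R^2$ be the circle with center $x$ and radius $r$, and for $\delta>0$ let $C^\delta$ denote the $\delta$-neighborhood of a circle $C$. Put $d(C(x,r),C(y,s))=|x-y|+|r-s|$. A family $\mathcal C$ of such circles is called $\delta$-separated if $d(C,C')>\delta$ for all distinct $C,C'\in\mathcal C$ (such a family is finite). Its multiplicity function is $\mu^{\mathcal C}_\delta=\sum_{C\in\mathcal C}\chi_{C^\delta}$. We write $|\cdot|$ both for cardinality and for Lebesgue measure in the plane. There is an absolute constant $\delta_0>0$ such that the following holds for all $0<\delta<\delta_0$. Let $\mathcal C$ be a nonempty $\delta$-separated family of circles $C(x,r)$ with $x\in[0,1]^2$, $r\in[1,2]$. Then there exists $\mathcal A\subset\mathcal C$ with $|\mathcal A|>\frac12|\mathcal C|$ such that $$\Bigl|\bigl\{y\in C^\delta : \mu^{\mathcal C}_\delta(y)>|\log\delta|^5\,\lambda^{-1}\,|\mathcal C|^{2/3}\bigr\}\Bigr|\le\lambda\,|C^\delta|$$ for all $C\in\mathcal A$ and all $0<\lambda<1$. -/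

import Mathlib

open MeasureTheory

/-- The plane `ℝ²` with its Euclidean norm and Lebesgue measure `volume`. -/
abbrev Plane : Type := EuclideanSpace ℝ (Fin 2)

/-- The circle `C(x, r)`, given by its center `x` and its radius `r`. -/
@[ext]
structure PlaneCircle where
  center : Plane
  radius : ℝ

namespace PlaneCircle

/-- The set of points of the circle `C(x, r)`. -/
def carrier (C : PlaneCircle) : Set Plane := Metric.sphere C.center C.radius

/-- The annulus `C^δ`, i.e. the `δ`-neighborhood of the circle `C`. -/
def annulus (C : PlaneCircle) (δ : ℝ) : Set Plane := Metric.thickening δ C.carrier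

/-- The distance `d(C(x, r), C(y, s)) = |x - y| + |r - s|`. -/
noncomputable def d (C C' : PlaneCircle) : ℝ :=
  ‖C.center - C'.center‖ + |C.radius - C'.radius|

/-- The circles under consideration: center in `[0,1]²` and radius in `[1,2]`. -/
def Admissible (C : PlaneCircle) : Prop :=
  (∀ i, C.center i ∈ Set.Icc (0 : ℝ) 1) ∧ C.radius ∈ Set.Icc (1 : ℝ) 2

end PlaneCircle

/-- A `δ`-separated three-parameter family of circles: the center and the radius both vary freely
(center in `[0,1]²`, radius in `[1,2]`), and `d(C, C') > δ` for distinct members. Such a family is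
automatically finite. -/
def IsSeparatedFamily (δ : ℝ) (𝒞 : Finset PlaneCircle) : Prop :=
  (∀ C ∈ 𝒞, C.Admissible) ∧ ∀ C ∈ 𝒞, ∀ C' ∈ 𝒞, C ≠ C' → δ < C.d C'

/-- The multiplicity function `μ_δ^𝒞 = ∑_{C ∈ 𝒞} χ_{C^δ}`. -/
noncomputable def circleMultiplicity (δ : ℝ) (𝒞 : Finset PlaneCircle) (y : Plane) : ℝ :=
  ∑ C ∈ 𝒞, (C.annulus δ).indicator (fun _ => (1 : ℝ)) y

/-! Three points at mutual distance at least `σ` lie in the annuli of only `O(σ⁻³)` members of a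
separated family (`card_le_of_three_points`). Indeed, for a point `p = x₀ + r₀e` of a base circle,
`|p - x|² - r²` is a linear form in `relCoord`, so the circles in question occupy a parallelepiped
of volume `O((δ/σ)³)`, packed by disjoint cubes of side comparable to `δ`.

Let `E = {μ > M}`, `N = |𝒞|`, and let `T` be the sum of the `|C^δ ∩ E|`. Double counting pairs of a
circle and a separated triple in `C^δ ∩ E`, with `σ` comparable to `T/(Nδ)`, and using `M|E| ≤ T`,
gives `TM = O(δ N^{5/3})` (`sum_volume_mul_le`). Summing over the `O(|log δ|)` dyadic levels `M =
2^j` and applying Markov's inequality over the circles yields one subfamily that serves all `λ` at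
once. -/

namespace PlaneCircle

/-! ### Annuli: membership and lower area bound. -/

theorem isOpen_annulus (C : PlaneCircle) (δ : ℝ) : IsOpen (C.annulus δ) :=
  Metric.isOpen_thickening

/-- A point of the annulus `C^δ` has distance less than `δ` from some point of `C`. -/
theorem mem_annulus_iff {C : PlaneCircle} {δ : ℝ} {z : Plane} :
    z ∈ C.annulus δ ↔ ∃ p : Plane, ‖p - C.center‖ = C.radius ∧ ‖z - p‖ < δ := by
  simp [annulus, carrier, Metric.mem_thickening_iff, dist_eq_norm]

theorem abs_norm_sub_lt_of_mem_annulus {C : PlaneCircle} {δ : ℝ} {z : Plane}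
    (hz : z ∈ C.annulus δ) : |‖z - C.center‖ - C.radius| < δ := by
  obtain ⟨p, hp, hzp⟩ := mem_annulus_iff.1 hz
  rw [← hp]
  refine (abs_norm_sub_norm_le _ _).trans_lt ?_
  simpa using hzp

theorem mem_annulus_of_radius_lt {C : PlaneCircle} {δ : ℝ} {z : Plane} (hr : 0 < C.radius)
    (h1 : C.radius < ‖z - C.center‖) (h2 : ‖z - C.center‖ < C.radius + δ) :
    z ∈ C.annulus δ := by
  have hn : 0 < ‖z - C.center‖ := hr.trans h1
  refine mem_annulus_iff.2 ⟨C.center + (C.radius / ‖z - C.center‖) • (z - C.center), ?_, ?_⟩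
  · rw [add_sub_cancel_left, norm_smul, Real.norm_of_nonneg (by positivity)]
    field_simp
  · have : z - (C.center + (C.radius / ‖z - C.center‖) • (z - C.center)) =
        (1 - C.radius / ‖z - C.center‖) • (z - C.center) := by
      rw [sub_smul, one_smul]; abel
    have h3 : C.radius / ‖z - C.center‖ < 1 := (div_lt_one hn).2 h1
    rw [this, norm_smul, Real.norm_of_nonneg (by linarith), sub_mul, div_mul_cancel₀ _ hn.ne']
    linarith

theorem ofReal_le_volume_annulus {C : PlaneCircle} {δ : ℝ} (hr : 1 ≤ C.radius) (hδ : 0 < δ) :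
    ENNReal.ofReal δ ≤ volume (C.annulus δ) := by
  have hsub : Metric.ball C.center (C.radius + δ) \ Metric.closedBall C.center C.radius ⊆
      C.annulus δ := fun z hz ↦ by
    simp only [Set.mem_sdiff, Metric.mem_ball, Metric.mem_closedBall, dist_eq_norm, not_le] at hz
    exact mem_annulus_of_radius_lt (by linarith) hz.2 hz.1
  refine le_trans ?_ (measure_mono hsub)
  rw [measure_sdiff (Metric.closedBall_subset_ball (by linarith))
    measurableSet_closedBall.nullMeasurableSet
    measure_closedBall_lt_top.ne, Measure.addHaar_closedBall_eq_addHaar_ball,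
    EuclideanSpace.volume_ball_fin_two, EuclideanSpace.volume_ball_fin_two,
    ← ENNReal.ofReal_pow (by linarith), ← ENNReal.ofReal_pow (by linarith),
    ← ENNReal.ofReal_mul (by positivity), ← ENNReal.ofReal_mul (by positivity),
    ← ENNReal.ofReal_sub _ (by positivity)]
  apply ENNReal.ofReal_le_ofReal
  nlinarith [Real.pi_gt_three, mul_le_mul_of_nonneg_right hr hδ.le, mul_pos hδ hδ, Real.pi_pos,
    mul_pos (mul_pos hδ hδ) Real.pi_pos]

end PlaneCircle

/-! ### Area of an annulus inside a small ball. -/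

theorem volume_le_of_sections_fst_le {A : Set (ℝ × ℝ)} (hA : MeasurableSet A) {I : Set ℝ}
    {m : ENNReal} (hI : ∀ z ∈ A, z.1 ∈ I) (hm : ∀ a, volume {b | (a, b) ∈ A} ≤ m) :
    volume A ≤ m * volume I := by
  rw [Measure.volume_eq_prod, Measure.prod_apply hA, ← setLIntegral_const]
  refine le_trans ?_ (lintegral_indicator_const_le I m |>.trans_eq
    (setLIntegral_const _ _).symm)
  refine lintegral_mono fun a ↦ ?_
  by_cases ha : a ∈ I
  · rw [Set.indicator_of_mem ha]
    exact hm a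
  · have : Prod.mk a ⁻¹' A = ∅ := by
      ext b; simpa using fun h ↦ ha (hI _ h)
    simp [this]

theorem volume_le_of_sections_snd_le {A : Set (ℝ × ℝ)} (hA : MeasurableSet A) {I : Set ℝ}
    {m : ENNReal} (hI : ∀ z ∈ A, z.2 ∈ I) (hm : ∀ b, volume {a | (a, b) ∈ A} ≤ m) :
    volume A ≤ m * volume I := by
  have h := volume_le_of_sections_fst_le (measurable_swap hA) (I := I) (m := m)
    (fun z hz ↦ hI _ hz) hm
  have hs := (Measure.measurePreserving_swap (μ := (volume : Measure ℝ))
    (ν := (volume : Measure ℝ))).measure_preimage hA.nullMeasurableSet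
  rw [← Measure.volume_eq_prod] at hs
  rwa [hs] at h

/-- The part of the line where the square of the coordinate is at least `1/4` and lies in a given
interval of length `4 r δ` is short. -/
theorem volume_sq_mem_Ioo_le {s r δ c : ℝ} (hδ : 0 < δ) (hr : r ≤ 2) :
    volume {b : ℝ | 1 / 2 ≤ |b - c| ∧ (r - δ) ^ 2 < s + (b - c) ^ 2 ∧
      s + (b - c) ^ 2 < (r + δ) ^ 2} ≤ ENNReal.ofReal (16 * δ) := by
  set H := {b : ℝ | 1 / 2 ≤ |b - c| ∧ (r - δ) ^ 2 < s + (b - c) ^ 2 ∧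
      s + (b - c) ^ 2 < (r + δ) ^ 2}
  -- On either side of `c`, two points satisfy `|a - b| · |(a - c) + (b - c)| ≤ 4rδ ≤ 8δ`, and the
  -- second factor is at least `1`.
  have hsub : H ⊆ (H ∩ {b | c ≤ b}) ∪ (H ∩ {b | b ≤ c}) := fun b hb ↦
    (le_total c b).imp (fun h ↦ ⟨hb, h⟩) (fun h ↦ ⟨hb, h⟩)
  have key : ∀ K : Set ℝ, (∀ a ∈ K, ∀ b ∈ K, |a - b| ≤ 8 * δ) →
      volume K ≤ ENNReal.ofReal (8 * δ) := fun K hK ↦ by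
    refine (Real.volume_le_diam K).trans (Metric.ediam_le fun a ha b hb ↦ ?_)
    rw [edist_dist, Real.dist_eq]
    exact ENNReal.ofReal_le_ofReal (hK a ha b hb)
  have h16 : ENNReal.ofReal (16 * δ) = ENNReal.ofReal (8 * δ) + ENNReal.ofReal (8 * δ) := by
    rw [← ENNReal.ofReal_add (by positivity) (by positivity)]; congr 1; ring
  rw [h16]
  refine (measure_mono hsub).trans ((measure_union_le _ _).trans (add_le_add ?_ ?_)) <;>
    refine key _ ?_ <;> rintro a ⟨⟨ha1, ha2, ha3⟩, ha⟩ b ⟨⟨hb1, hb2, hb3⟩, hb⟩ <;>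
    simp only [Set.mem_ofPred_eq] at ha hb
  · rw [abs_of_nonneg (by linarith)] at ha1 hb1
    rw [abs_le]; constructor <;> nlinarith
  · rw [abs_of_nonpos (by linarith)] at ha1 hb1
    rw [abs_le]; constructor <;> nlinarith

theorem Plane.volume_eq_preimage {A : Set (ℝ × ℝ)} (hA : MeasurableSet A) :
    volume {z : Plane | (z 0, z 1) ∈ A} = volume A := by
  have h := (volume_preserving_finTwoArrow ℝ).comp (PiLp.volume_preserving_ofLp (Fin 2))
  exact h.measure_preimage hA.nullMeasurableSet

theorem Plane.norm_sq (z : Plane) : ‖z‖ ^ 2 = z 0 ^ 2 + z 1 ^ 2 := by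
  simp [EuclideanSpace.norm_sq_eq]

/-- Since `r - δ ≥ 3/4` and `9/16 > 1/4 + 1/4`, each point of the annulus has a coordinate at
distance at least `1/2` from that of the center. The other coordinate runs over an interval of
length `2σ`, with sections of length at most `16δ`; the two cases add up. -/
theorem PlaneCircle.volume_annulus_inter_ball_le {C : PlaneCircle} {δ σ : ℝ} (y : Plane)
    (hr1 : 1 ≤ C.radius) (hr2 : C.radius ≤ 2) (hδ : 0 < δ) (hδ' : δ ≤ 1 / 4) (hσ : 0 ≤ σ) :
    volume (C.annulus δ ∩ Metric.ball y σ) ≤ ENNReal.ofReal (64 * σ * δ) := by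
  set x := C.center with hx
  set r := C.radius with hr
  let A₁ : Set (ℝ × ℝ) := {z | z.1 ∈ Set.Ioo (y 0 - σ) (y 0 + σ)} ∩
    ({z | 1 / 2 ≤ |z.2 - x 1|} ∩
    ({z | (r - δ) ^ 2 < (z.1 - x 0) ^ 2 + (z.2 - x 1) ^ 2} ∩
    {z | (z.1 - x 0) ^ 2 + (z.2 - x 1) ^ 2 < (r + δ) ^ 2}))
  let A₂ : Set (ℝ × ℝ) := {z | z.2 ∈ Set.Ioo (y 1 - σ) (y 1 + σ)} ∩
    ({z | 1 / 2 ≤ |z.1 - x 0|} ∩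
    ({z | (r - δ) ^ 2 < (z.2 - x 1) ^ 2 + (z.1 - x 0) ^ 2} ∩
    {z | (z.2 - x 1) ^ 2 + (z.1 - x 0) ^ 2 < (r + δ) ^ 2}))
  have hA₁ : MeasurableSet A₁ :=
    (measurableSet_Ioo.preimage measurable_fst).inter
      ((measurableSet_le (by fun_prop) (by fun_prop)).inter
      ((measurableSet_lt (by fun_prop) (by fun_prop)).inter
      (measurableSet_lt (by fun_prop) (by fun_prop))))
  have hA₂ : MeasurableSet A₂ :=
    (measurableSet_Ioo.preimage measurable_snd).inter
      ((measurableSet_le (by fun_prop) (by fun_prop)).inter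
      ((measurableSet_lt (by fun_prop) (by fun_prop)).inter
      (measurableSet_lt (by fun_prop) (by fun_prop))))
  have hv₁ : volume A₁ ≤ ENNReal.ofReal (32 * σ * δ) := by
    refine (volume_le_of_sections_fst_le hA₁ (I := Set.Ioo (y 0 - σ) (y 0 + σ)) (fun z hz ↦ hz.1)
      fun a ↦
      (measure_mono fun b hb ↦ hb.2).trans
        (volume_sq_mem_Ioo_le (s := (a - x 0) ^ 2) (c := x 1) hδ hr2)).trans_eq ?_
    rw [Real.volume_Ioo, ← ENNReal.ofReal_mul (by positivity)]
    congr 1; ring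
  have hv₂ : volume A₂ ≤ ENNReal.ofReal (32 * σ * δ) := by
    refine (volume_le_of_sections_snd_le hA₂ (I := Set.Ioo (y 1 - σ) (y 1 + σ)) (fun z hz ↦ hz.1)
      fun a ↦
      (measure_mono fun b hb ↦ hb.2).trans
        (volume_sq_mem_Ioo_le (s := (a - x 1) ^ 2) (c := x 0) hδ hr2)).trans_eq ?_
    rw [Real.volume_Ioo, ← ENNReal.ofReal_mul (by positivity)]
    congr 1; ring
  have hsub : C.annulus δ ∩ Metric.ball y σ ⊆
      {z : Plane | (z 0, z 1) ∈ A₁} ∪ {z : Plane | (z 0, z 1) ∈ A₂} := by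
    rintro z ⟨hz, hzy⟩
    have h1 := abs_lt.1 (abs_norm_sub_lt_of_mem_annulus hz)
    rw [← hx, ← hr] at h1
    have h2 := Plane.norm_sq (z - x)
    have h3 : ‖z - y‖ < σ := by simpa [dist_eq_norm] using hzy
    have h4 := Plane.norm_sq (z - y)
    simp only [PiLp.sub_apply] at h2 h4
    have hlow : (r - δ) ^ 2 < ‖z - x‖ ^ 2 := by
      apply pow_lt_pow_left₀ <;> linarith
    have hup : ‖z - x‖ ^ 2 < (r + δ) ^ 2 :=
      pow_lt_pow_left₀ (by linarith) (norm_nonneg _) (by norm_num)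
    have h5 : ‖z - y‖ ^ 2 < σ ^ 2 := pow_lt_pow_left₀ h3 (norm_nonneg _) (by norm_num)
    have h0 := abs_lt.1 (abs_lt_of_sq_lt_sq (a := z 0 - y 0)
      (by nlinarith [sq_nonneg (z 1 - y 1)]) hσ)
    have h1' := abs_lt.1 (abs_lt_of_sq_lt_sq (a := z 1 - y 1)
      (by nlinarith [sq_nonneg (z 0 - y 0)]) hσ)
    rcases le_or_gt (1 / 2) |z 1 - x 1| with h | h
    · left
      rw [h2] at hlow hup
      exact ⟨⟨by linarith, by linarith⟩, h, hlow, hup⟩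
    · right
      suffices hfst : 1 / 2 ≤ |z 0 - x 0| by
        rw [h2, add_comm] at hlow hup
        exact ⟨⟨by linarith, by linarith⟩, hfst, hlow, hup⟩
      by_contra! h'
      have e1 := sq_lt_sq' (abs_lt.1 h).1 (abs_lt.1 h).2
      have e2 := sq_lt_sq' (abs_lt.1 h').1 (abs_lt.1 h').2
      have : (3 / 4 : ℝ) ≤ r - δ := by linarith
      nlinarith
  calc volume (C.annulus δ ∩ Metric.ball y σ) ≤ volume A₁ + volume A₂ := by
        rw [← Plane.volume_eq_preimage hA₁, ← Plane.volume_eq_preimage hA₂]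
        exact (measure_mono hsub).trans (measure_union_le _ _)
    _ ≤ ENNReal.ofReal (32 * σ * δ) + ENNReal.ofReal (32 * σ * δ) := add_le_add hv₁ hv₂
    _ = ENNReal.ofReal (64 * σ * δ) := by
        rw [← ENNReal.ofReal_add (by positivity) (by positivity)]; congr 1; ring

/-! ### Packing, linear coordinates, and circles near three points. -/

/-- Disjoint cubes of side `2ρ` inside a set of finite volume. -/
theorem card_mul_le_volume_of_separated {ι : Type*} {s : Finset ι} {f : ι → Fin 3 → ℝ} {ρ : ℝ}
    (hρ : 0 < ρ) {P : Set (Fin 3 → ℝ)}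
    (hsep : ∀ i ∈ s, ∀ j ∈ s, i ≠ j → 2 * ρ ≤ dist (f i) (f j))
    (hP : ∀ i ∈ s, Metric.ball (f i) ρ ⊆ P) :
    s.card * ENNReal.ofReal ((2 * ρ) ^ 3) ≤ volume P := by
  have hd : (s : Set ι).PairwiseDisjoint fun i ↦ Metric.ball (f i) ρ := fun i hi j hj hij ↦
    Metric.ball_disjoint_ball (by linarith [hsep i hi j hj hij])
  have h := measure_biUnion_finset (μ := volume) hd fun _ _ ↦ measurableSet_ball
  simp only [Real.volume_pi_ball _ hρ, Fintype.card_fin, Finset.sum_const, nsmul_eq_mul] at h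
  rw [← h]
  exact measure_mono (Set.iUnion₂_subset hP)

/-- The determinant of three unit vectors bordered by ones, through the circumradius formula. -/
theorem sq_cross_eq_of_unit {a b c d e f : ℝ} (h1 : a ^ 2 + b ^ 2 = 1) (h2 : c ^ 2 + d ^ 2 = 1)
    (h3 : e ^ 2 + f ^ 2 = 1) :
    4 * ((c - a) * (f - b) - (d - b) * (e - a)) ^ 2 =
      ((c - a) ^ 2 + (d - b) ^ 2) * ((e - a) ^ 2 + (f - b) ^ 2) *
        ((e - c) ^ 2 + (f - d) ^ 2) := by
  grind

theorem PlaneCircle.sub_norm_sq_le {x p y : Plane} {r δ : ℝ} (hr : r ≤ 2) (hr0 : 0 ≤ r) (hδ : 0 < δ)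
    (hδ' : δ ≤ 1 / 4) (h : |‖y - x‖ - r| < δ) (hp : ‖y - p‖ < δ) :
    |‖p - x‖ ^ 2 - r ^ 2| ≤ 12 * δ := by
  have h1 : |‖p - x‖ - ‖y - x‖| ≤ ‖y - p‖ := by
    refine (abs_norm_sub_norm_le _ _).trans_eq ?_
    rw [sub_sub_sub_cancel_right, norm_sub_rev]
  rw [abs_lt] at h
  rw [abs_le] at h1 ⊢
  have := norm_nonneg (p - x)
  constructor <;> nlinarith

/-- Linear coordinates in which, relative to a base circle, passing near a given point of the base
circle is a linear condition. -/
noncomputable def PlaneCircle.relCoord (C₀ C : PlaneCircle) : Fin 3 → ℝ :=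
  ![‖C.center - C₀.center‖ ^ 2 + C₀.radius ^ 2 - C.radius ^ 2,
    2 * C₀.radius * (C.center 0 - C₀.center 0), 2 * C₀.radius * (C.center 1 - C₀.center 1)]

theorem Plane.abs_apply_le (z : Plane) (i : Fin 2) : |z i| ≤ ‖z‖ := by
  simpa using PiLp.norm_apply_le z i

theorem Plane.norm_le_add (z : Plane) : ‖z‖ ≤ |z 0| + |z 1| := by
  refine abs_le_of_sq_le_sq' ?_ (by positivity) |>.2
  rw [Plane.norm_sq, ← sq_abs (z 0), ← sq_abs (z 1)]
  nlinarith [abs_nonneg (z 0), abs_nonneg (z 1)]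

namespace PlaneCircle

theorem Admissible.norm_sub_le {C C' : PlaneCircle} (hC : C.Admissible) (hC' : C'.Admissible) :
    ‖C.center - C'.center‖ ≤ 2 := by
  refine (Plane.norm_le_add _).trans ?_
  have h : ∀ i, |(C.center - C'.center) i| ≤ 1 := fun i ↦ by
    have h1 := hC.1 i
    have h2 := hC'.1 i
    rw [PiLp.sub_apply, abs_le]
    constructor <;> linarith [h1.1, h1.2, h2.1, h2.2]
  linarith [h 0, h 1]

/-- As `r₀ ≥ 1`, the last two coordinates control the center; the first then controls `r²`, hence
`r`, because radii are at least `1`. Closeness `δ/4` in coordinates would force `d ≤ δ/4 + 5δ/8 <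
δ`. -/
theorem le_dist_relCoord {C₀ C C' : PlaneCircle} (h₀ : C₀.Admissible) (hC : C.Admissible)
    (hC' : C'.Admissible) {δ : ℝ} (hd : δ < C.d C') :
    2 * (δ / 8) ≤ dist (C₀.relCoord C) (C₀.relCoord C') := by
  by_contra! h
  have hk : ∀ k, |C₀.relCoord C k - C₀.relCoord C' k| < δ / 4 := fun k ↦ by
    have := dist_le_pi_dist (C₀.relCoord C) (C₀.relCoord C') k
    rw [Real.dist_eq] at this
    linarith
  have k0 := hk 0
  have k1 := hk 1
  have k2 := hk 2
  simp only [relCoord, Matrix.cons_val] at k0 k1 k2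
  have hr0 := h₀.2.1
  have hcoord : ∀ i, |2 * C₀.radius * (C.center i - C₀.center i) -
      2 * C₀.radius * (C'.center i - C₀.center i)| < δ / 4 →
      |(C.center - C'.center) i| ≤ δ / 8 := fun i hi ↦ by
    rw [← mul_sub, sub_sub_sub_cancel_right, abs_mul, abs_of_nonneg (by linarith)] at hi
    rw [PiLp.sub_apply]
    nlinarith [abs_nonneg (C.center i - C'.center i)]
  have hv : ‖C.center - C'.center‖ ≤ δ / 4 := by
    linarith [Plane.norm_le_add (C.center - C'.center), hcoord 0 k1, hcoord 1 k2]
  have hq : |‖C.center - C₀.center‖ - ‖C'.center - C₀.center‖| ≤ δ / 4 := by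
    refine (abs_norm_sub_norm_le _ _).trans ?_
    rwa [sub_sub_sub_cancel_right]
  have hn := hC.norm_sub_le h₀
  have hn' := hC'.norm_sub_le h₀
  have hp := norm_nonneg (C.center - C₀.center)
  have hp' := norm_nonneg (C'.center - C₀.center)
  have hr1 := hC.2.1
  have hr2 := hC'.2.1
  have hsq : |‖C.center - C₀.center‖ ^ 2 - ‖C'.center - C₀.center‖ ^ 2| ≤ δ := by
    rw [sq_sub_sq, abs_mul, abs_of_nonneg (a := _ + _) (by linarith)]
    nlinarith [abs_nonneg (‖C.center - C₀.center‖ - ‖C'.center - C₀.center‖)]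
  have hrr : |C.radius ^ 2 - C'.radius ^ 2| ≤ 5 / 4 * δ := by
    rw [abs_le] at hsq ⊢
    rw [abs_lt] at k0
    constructor <;> linarith
  have hr : |C.radius - C'.radius| ≤ 5 / 8 * δ := by
    rw [sq_sub_sq, abs_mul, abs_of_nonneg (a := _ + _) (by linarith)] at hrr
    nlinarith [abs_nonneg (C.radius - C'.radius)]
  have : 0 ≤ ‖C.center - C'.center‖ := norm_nonneg _
  unfold d at hd
  linarith

/-- The linear form, in relative coordinates, attached to the point `p` of the base circle. -/
theorem abs_relCoord_form_le {C₀ C : PlaneCircle} (hC : C.Admissible) {δ : ℝ}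
    (hδ : 0 < δ) (hδ' : δ ≤ 1 / 4) {p y e : Plane} (hp : p - C₀.center = C₀.radius • e)
    (he : ‖e‖ = 1) (hyp : ‖y - p‖ < δ) (hy : y ∈ C.annulus δ) :
    |C₀.relCoord C 0 - e 0 * C₀.relCoord C 1 - e 1 * C₀.relCoord C 2| ≤ 12 * δ := by
  have h := sub_norm_sq_le hC.2.2 (by linarith [hC.2.1]) hδ hδ'
    (abs_norm_sub_lt_of_mem_annulus hy) hyp
  have e1 : p = C₀.center + C₀.radius • e := by rw [← hp]; abel
  have he2 := Plane.norm_sq e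
  rw [he] at he2
  have e2 := Plane.norm_sq (p - C.center)
  have e3 := Plane.norm_sq (C.center - C₀.center)
  rw [e1] at e2
  simp only [PiLp.sub_apply, PiLp.add_apply, PiLp.smul_apply, smul_eq_mul] at e2 e3
  simp only [relCoord, Matrix.cons_val]
  convert h using 2
  rw [e1, e2, e3]
  linear_combination C₀.radius ^ 2 * he2

end PlaneCircle

/-- The determinant of the three forms is, up to sign, twice the area of the triangle `e₀e₁e₂`. Its
circumradius is `1`, so this is half the product of the sides, at least `τ³/2`. -/
theorem volume_abs_forms_le {e : Fin 3 → Plane} (he : ∀ i, ‖e i‖ = 1) {τ R : ℝ} (hτ : 0 < τ)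
    (hR : 0 ≤ R) (hsep : ∀ i j, i ≠ j → τ ≤ ‖e i - e j‖) :
    volume {w : Fin 3 → ℝ | ∀ i, |w 0 - e i 0 * w 1 - e i 1 * w 2| ≤ R} ≤
      ENNReal.ofReal (16 * R ^ 3 / τ ^ 3) := by
  let A : Matrix (Fin 3) (Fin 3) ℝ := Matrix.of fun i ↦ ![1, -e i 0, -e i 1]
  have hset : {w : Fin 3 → ℝ | ∀ i, |w 0 - e i 0 * w 1 - e i 1 * w 2| ≤ R} =
      (Matrix.toLin' A) ⁻¹' Metric.closedBall 0 R := by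
    ext w
    simp only [Set.mem_ofPred_eq, Set.mem_preimage, mem_closedBall_zero_iff,
      pi_norm_le_iff_of_nonneg hR, Matrix.toLin'_apply, Real.norm_eq_abs]
    refine forall_congr' fun i ↦ ?_
    simp [A, Matrix.mulVec, dotProduct, Fin.sum_univ_three, sub_eq_add_neg]
  have hn : ∀ i, e i 0 ^ 2 + e i 1 ^ 2 = 1 := fun i ↦ by rw [← Plane.norm_sq, he, one_pow]
  have hdet : A.det = (e 1 0 - e 0 0) * (e 2 1 - e 0 1) - (e 1 1 - e 0 1) * (e 2 0 - e 0 0) := by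
    rw [Matrix.det_fin_three]
    simp only [A, Matrix.of_apply, Matrix.cons_val]
    ring
  have hs : ∀ i j, i ≠ j → τ ^ 2 ≤ (e i 0 - e j 0) ^ 2 + (e i 1 - e j 1) ^ 2 := fun i j hij ↦ by
    have := pow_le_pow_left₀ hτ.le (hsep i j hij) 2
    rwa [Plane.norm_sq] at this
  have hsq : (τ ^ 3) ^ 2 ≤ (2 * A.det) ^ 2 := by
    have := sq_cross_eq_of_unit (hn 0) (hn 1) (hn 2)
    rw [hdet, mul_pow]
    norm_num only
    rw [this]
    calc (τ ^ 3) ^ 2 = τ ^ 2 * τ ^ 2 * τ ^ 2 := by ring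
      _ ≤ _ := mul_le_mul (mul_le_mul (hs 1 0 (by decide)) (hs 2 0 (by decide)) (by positivity)
        (by positivity)) (hs 2 1 (by decide)) (by positivity) (by positivity)
  have habs : τ ^ 3 / 2 ≤ |A.det| := by
    have := sq_le_sq.1 hsq
    rw [abs_of_pos (by positivity), abs_mul, abs_two] at this
    linarith
  have hpos : 0 < |A.det| := lt_of_lt_of_le (by positivity) habs
  rw [hset, Measure.addHaar_preimage_linearMap _ (by
    rw [LinearMap.det_toLin']; exact abs_pos.1 hpos), LinearMap.det_toLin',
    Real.volume_pi_closedBall _ hR, ← ENNReal.ofReal_mul (abs_nonneg _), abs_inv,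
    Fintype.card_fin]
  apply ENNReal.ofReal_le_ofReal
  calc |A.det|⁻¹ * (2 * R) ^ 3 ≤ (τ ^ 3 / 2)⁻¹ * (2 * R) ^ 3 := by gcongr
    _ = 16 * R ^ 3 / τ ^ 3 := by field_simp; ring

/-- Few circles of a `δ`-separated family pass near three well separated points. -/
theorem card_le_of_three_points {δ σ : ℝ} {𝒟 : Finset PlaneCircle} (h : IsSeparatedFamily δ 𝒟)
    (hδ : 0 < δ) (hδ' : δ ≤ 1 / 4) (hσ : 4 * δ ≤ σ) {y : Fin 3 → Plane}
    (hy : ∀ i j, i ≠ j → σ ≤ ‖y i - y j‖) (hmem : ∀ C ∈ 𝒟, ∀ i, y i ∈ C.annulus δ) :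
    (𝒟.card : ℝ) ≤ 10 ^ 9 / σ ^ 3 := by
  have hσ0 : 0 < σ := by linarith
  rcases 𝒟.eq_empty_or_nonempty with rfl | ⟨C₀, hC₀⟩
  · simp; positivity
  have had₀ := h.1 C₀ hC₀
  have hr : 1 ≤ C₀.radius := had₀.2.1
  have hr' : C₀.radius ≤ 2 := had₀.2.2
  choose p hp hyp using fun i ↦ PlaneCircle.mem_annulus_iff.1 (hmem C₀ hC₀ i)
  let e : Fin 3 → Plane := fun i ↦ C₀.radius⁻¹ • (p i - C₀.center)
  have hpe : ∀ i, p i - C₀.center = C₀.radius • e i := fun i ↦ by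
    simp only [e]; rw [smul_inv_smul₀ (by linarith)]
  have he : ∀ i, ‖e i‖ = 1 := fun i ↦ by
    simp only [e]
    rw [norm_smul, hp, norm_inv, Real.norm_of_nonneg (by linarith)]
    exact inv_mul_cancel₀ (by linarith)
  -- Moving to the base circle costs `2δ ≤ σ/2`, and rescaling by `r₀ ≤ 2` halves the rest.
  have hsep : ∀ i j, i ≠ j → σ / 4 ≤ ‖e i - e j‖ := fun i j hij ↦ by
    have h1 : p i - p j = C₀.radius • (e i - e j) := by
      rw [smul_sub, ← hpe, ← hpe]; abel
    have h2 : ‖p i - p j‖ = C₀.radius * ‖e i - e j‖ := by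
      rw [h1, norm_smul, Real.norm_of_nonneg (by linarith)]
    have h3 : ‖y i - y j‖ ≤ ‖y i - p i‖ + ‖p i - p j‖ + ‖y j - p j‖ := by
      have : y i - y j = (y i - p i) + (p i - p j) - (y j - p j) := by abel
      rw [this]
      exact (norm_sub_le _ _).trans (add_le_add_left (norm_add_le _ _) _)
    nlinarith [hy i j hij, hyp i, hyp j, norm_nonneg (e i - e j)]
  -- The slack from `12δ` to `13δ` accommodates the cubes: each form varies by at most `3δ/8` on
  -- them.
  have hpack := card_mul_le_volume_of_separated (s := 𝒟) (f := C₀.relCoord) (ρ := δ / 8)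
    (P := {w : Fin 3 → ℝ | ∀ i, |w 0 - e i 0 * w 1 - e i 1 * w 2| ≤ 13 * δ}) (by positivity)
    (fun C hC C' hC' hne ↦ PlaneCircle.le_dist_relCoord had₀ (h.1 C hC) (h.1 C' hC')
      (h.2 C hC C' hC' hne)) (fun C hC w hw i ↦ by
      have h1 := PlaneCircle.abs_relCoord_form_le (h.1 C hC) hδ hδ' (hpe i) (he i) (hyp i)
        (hmem C hC i)
      have hk : ∀ k, |w k - C₀.relCoord C k| ≤ δ / 8 := fun k ↦ by
        have := dist_le_pi_dist w (C₀.relCoord C) k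
        rw [Real.dist_eq] at this
        exact this.trans (Metric.mem_ball.1 hw).le
      have e0 : |e i 0 * (w 1 - C₀.relCoord C 1)| ≤ δ / 8 := by
        rw [abs_mul]
        refine (mul_le_of_le_one_left (abs_nonneg _) ?_).trans (hk 1)
        exact (Plane.abs_apply_le _ _).trans_eq (he i)
      have e1 : |e i 1 * (w 2 - C₀.relCoord C 2)| ≤ δ / 8 := by
        rw [abs_mul]
        refine (mul_le_of_le_one_left (abs_nonneg _) ?_).trans (hk 2)
        exact (Plane.abs_apply_le _ _).trans_eq (he i)
      have k0 := hk 0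
      rw [abs_le] at h1 e0 e1 k0 ⊢
      constructor <;> linarith)
  have hle := hpack.trans (volume_abs_forms_le (τ := σ / 4) (R := 13 * δ) he
    (by positivity) (by positivity) hsep)
  have hR : 0 ≤ 16 * (13 * δ) ^ 3 / (σ / 4) ^ 3 := by positivity
  rw [← ENNReal.ofReal_natCast, ← ENNReal.ofReal_mul (Nat.cast_nonneg _),
    ENNReal.ofReal_le_ofReal_iff hR] at hle
  rw [le_div_iff₀ (by positivity)] at hle ⊢
  have hδ3 : 0 < δ ^ 3 := by positivity
  refine le_of_mul_le_mul_right ?_ hδ3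
  nlinarith

/-- A packing bound in `(x, r)`-space. It limits the number of dyadic levels and settles the case of
small `σ` in the weak-type bound. -/
theorem IsSeparatedFamily.card_le {δ : ℝ} {𝒞 : Finset PlaneCircle} (h : IsSeparatedFamily δ 𝒞)
    (hδ : 0 < δ) (hδ' : δ ≤ 1 / 4) : (𝒞.card : ℝ) * δ ^ 3 ≤ 8000 := by
  have hpack := card_mul_le_volume_of_separated (s := 𝒞)
    (f := fun C ↦ ![C.center 0, C.center 1, C.radius]) (ρ := δ / 8)
    (P := Metric.ball 0 (5 / 2)) (by positivity)
    (fun C hC C' hC' hne ↦ by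
      by_contra! hlt
      have hk : ∀ k, |(![C.center 0, C.center 1, C.radius] : Fin 3 → ℝ) k -
          (![C'.center 0, C'.center 1, C'.radius] : Fin 3 → ℝ) k| < δ / 4 := fun k ↦ by
        have := dist_le_pi_dist (![C.center 0, C.center 1, C.radius] : Fin 3 → ℝ)
          ![C'.center 0, C'.center 1, C'.radius] k
        rw [Real.dist_eq] at this
        linarith
      have k0 := hk 0
      have k1 := hk 1
      have k2 := hk 2
      simp only [Matrix.cons_val] at k0 k1 k2
      have h1 := h.2 C hC C' hC' hne
      have h2 := Plane.norm_le_add (C.center - C'.center)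
      simp only [PiLp.sub_apply] at h2
      unfold PlaneCircle.d at h1
      linarith)
    (fun C hC ↦ by
      have had := h.1 C hC
      have h0 := had.1 0
      have h1 := had.1 1
      have h2 := had.2
      refine Metric.ball_subset_ball' (ε₁ := δ / 8) ?_
      have : dist (![C.center 0, C.center 1, C.radius] : Fin 3 → ℝ) 0 ≤ 2 := by
        rw [dist_pi_le_iff (by norm_num)]
        intro k
        fin_cases k <;> simp [abs_le] <;> constructor <;>
          linarith [h0.1, h0.2, h1.1, h1.2, h2.1, h2.2]
      linarith)
  rw [Real.volume_pi_ball _ (by norm_num), ← ENNReal.ofReal_natCast,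
    ← ENNReal.ofReal_mul (by positivity), ENNReal.ofReal_le_ofReal_iff (by positivity)] at hpack
  norm_num at hpack
  nlinarith

/-! ### Separated triples and double counting. -/

theorem mul_measure_le_prod_of_le_section {α β : Type*} [MeasurableSpace α] [MeasurableSpace β]
    {μ : Measure α} {ν : Measure β} [SFinite ν] {A : Set (α × β)} (hA : MeasurableSet A)
    {S : Set α} (hS : MeasurableSet S) {c : ENNReal} (hc : ∀ x ∈ S, c ≤ ν (Prod.mk x ⁻¹' A)) :
    c * μ S ≤ μ.prod ν A := by
  rw [Measure.prod_apply hA, ← setLIntegral_const]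
  exact (setLIntegral_mono' hS hc).trans (setLIntegral_le_lintegral _ _)

/-- The triples of pairwise `σ`-separated points of `S`. -/
def separatedTriples (S : Set Plane) (σ : ℝ) : Set (Plane × Plane × Plane) :=
  {p | p.1 ∈ S} ∩ ({p | p.2.1 ∈ S} ∩ ({p | p.2.2 ∈ S} ∩ ({p | σ ≤ ‖p.1 - p.2.1‖} ∩
    ({p | σ ≤ ‖p.1 - p.2.2‖} ∩ {p | σ ≤ ‖p.2.1 - p.2.2‖}))))

theorem measurableSet_separatedTriples {S : Set Plane} (hS : MeasurableSet S) (σ : ℝ) :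
    MeasurableSet (separatedTriples S σ) :=
  (hS.preimage measurable_fst).inter <|
    (hS.preimage (measurable_fst.comp measurable_snd)).inter <|
    (hS.preimage (measurable_snd.comp measurable_snd)).inter <|
    (measurableSet_le (by fun_prop) (by fun_prop)).inter <|
    (measurableSet_le (by fun_prop) (by fun_prop)).inter
    (measurableSet_le (by fun_prop) (by fun_prop))

/-- Choose the points one after another: each earlier point forbids a ball that removes at most `a`
from `S`, so every choice leaves at least `|S| - 2a`. -/
theorem pow_le_volume_separatedTriples {S : Set Plane} (hS : MeasurableSet S) {σ : ℝ} {a : ENNReal}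
    (ha : ∀ y, volume (S ∩ Metric.ball y σ) ≤ a) :
    (volume S - 2 * a) ^ 3 ≤ volume (separatedTriples S σ) := by
  set m := volume S - 2 * a
  have hT := measurableSet_separatedTriples hS σ
  have h1 : ∀ y, m ≤ volume (S \ Metric.ball y σ) := fun y ↦ by
    refine le_trans ?_ (le_measure_sdiff (μ := volume) (s₁ := S) (s₂ := S ∩ Metric.ball y σ)
      |>.trans_eq (by rw [Set.sdiff_self_inter]))
    refine tsub_le_tsub_left ((ha y).trans ?_) _
    rw [two_mul]; exact le_self_add
  have h2 : ∀ y z, m ≤ volume (S \ (Metric.ball y σ ∪ Metric.ball z σ)) := fun y z ↦ by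
    refine le_trans ?_ (le_measure_sdiff (μ := volume)
      (s₁ := S) (s₂ := S ∩ (Metric.ball y σ ∪ Metric.ball z σ))
      |>.trans_eq (by rw [Set.sdiff_self_inter]))
    refine tsub_le_tsub_left ?_ _
    rw [Set.inter_union_distrib_left, two_mul]
    exact (measure_union_le _ _).trans (add_le_add (ha y) (ha z))
  have hslice : ∀ y ∈ S, m * m ≤ volume (Prod.mk y ⁻¹' separatedTriples S σ) := fun y hy ↦ by
    refine (mul_le_mul_right (h1 y) m).trans ?_
    refine mul_measure_le_prod_of_le_section (measurable_prodMk_left hT)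
      (hS.diff measurableSet_ball) fun z hz ↦ (h2 y z).trans (measure_mono fun w hw ↦ ?_)
    simp only [Set.mem_sdiff, Set.mem_union, Metric.mem_ball, dist_eq_norm, not_or, not_lt] at hz hw
    exact ⟨hy, hz.1, hw.1, by simpa [norm_sub_rev] using hz.2,
      by simpa [norm_sub_rev] using hw.2.1, by simpa [norm_sub_rev] using hw.2.2⟩
  calc m ^ 3 = m * m * m := by ring
    _ ≤ m * m * volume S := by gcongr; exact tsub_le_self
    _ ≤ _ := mul_measure_le_prod_of_le_section hT hS hslice

theorem IsSeparatedFamily.mono {δ : ℝ} {𝒞 𝒟 : Finset PlaneCircle} (h : IsSeparatedFamily δ 𝒞)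
    (hs : 𝒟 ⊆ 𝒞) : IsSeparatedFamily δ 𝒟 :=
  ⟨fun C hC ↦ h.1 C (hs hC), fun C hC C' hC' ↦ h.2 C (hs hC) C' (hs hC')⟩

/-- Double counting of circles and separated triples of points on them. -/
theorem sum_volume_separatedTriples_le {δ σ : ℝ} {𝒞 : Finset PlaneCircle}
    (h : IsSeparatedFamily δ 𝒞) (hδ : 0 < δ) (hδ' : δ ≤ 1 / 4) (hσ : 4 * δ ≤ σ) {E : Set Plane}
    (hE : MeasurableSet E) :
    ∑ C ∈ 𝒞, volume (separatedTriples (C.annulus δ ∩ E) σ) ≤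
      ENNReal.ofReal (10 ^ 9 / σ ^ 3) * volume E ^ 3 := by
  classical
  have hm : ∀ C : PlaneCircle, MeasurableSet (separatedTriples (C.annulus δ ∩ E) σ) := fun C ↦
    measurableSet_separatedTriples ((C.isOpen_annulus δ).measurableSet.inter hE) σ
  have hvol : volume (E ×ˢ E ×ˢ E) = volume E ^ 3 := by
    rw [Measure.volume_eq_prod, Measure.prod_prod, Measure.volume_eq_prod, Measure.prod_prod]
    ring
  rw [← hvol, ← lintegral_indicator_const (hE.prod (hE.prod hE))]
  simp_rw [← fun C ↦ lintegral_indicator_one (μ := volume) (hm C)]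
  rw [← lintegral_finsetSum _ fun C _ ↦ measurable_one.indicator (hm C)]
  refine lintegral_mono fun p ↦ ?_
  by_cases hp : p ∈ E ×ˢ E ×ˢ E
  · rw [Set.indicator_of_mem hp]
    set 𝒟 := 𝒞.filter fun C ↦ p ∈ separatedTriples (C.annulus δ ∩ E) σ with h𝒟
    have hsum : ∑ C ∈ 𝒞, (separatedTriples (C.annulus δ ∩ E) σ).indicator 1 p =
        (𝒟.card : ENNReal) := by
      simp only [Set.indicator_apply, Pi.one_apply, h𝒟, Finset.sum_ite, Finset.sum_const_zero,
        add_zero, Finset.sum_const, nsmul_eq_mul, mul_one]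
    rw [hsum]
    rcases 𝒟.eq_empty_or_nonempty with he | ⟨C₀, hC₀⟩
    · simp [he]
    obtain ⟨-, -, -, h01, h02, h12⟩ := (Finset.mem_filter.1 hC₀).2
    rw [← ENNReal.ofReal_natCast]
    refine ENNReal.ofReal_le_ofReal (card_le_of_three_points (y := ![p.1, p.2.1, p.2.2])
      (h.mono (Finset.filter_subset _ _)) hδ hδ' hσ ?_ ?_)
    · have h01' : σ ≤ ‖p.1 - p.2.1‖ := h01
      have h02' : σ ≤ ‖p.1 - p.2.2‖ := h02
      have h12' : σ ≤ ‖p.2.1 - p.2.2‖ := h12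
      intro i j hij
      fin_cases i <;> fin_cases j <;> simp at hij ⊢ <;>
        first | assumption | (rw [norm_sub_rev]; assumption)
    · intro C hC i
      obtain ⟨h0, h1, h2, -⟩ := (Finset.mem_filter.1 hC).2
      fin_cases i
      exacts [h0.1, h1.1, h2.1]
  · refine le_of_eq_of_le (Finset.sum_eq_zero fun C _ ↦ Set.indicator_of_notMem ?_ _) zero_le
    rintro ⟨h0, h1, h2, -⟩
    exact hp ⟨h0.2, h1.2, h2.2⟩

/-! ### Weak-type bound for the multiplicity function. -/

theorem measurable_circleMultiplicity (δ : ℝ) (𝒞 : Finset PlaneCircle) :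
    Measurable (circleMultiplicity δ 𝒞) :=
  Finset.measurable_fun_sum _ fun C _ ↦
    measurable_const.indicator (C.isOpen_annulus δ).measurableSet

theorem circleMultiplicity_le_card (δ : ℝ) (𝒞 : Finset PlaneCircle) (y : Plane) :
    circleMultiplicity δ 𝒞 y ≤ 𝒞.card := by
  refine (Finset.sum_le_card_nsmul _ _ 1 fun C _ ↦ ?_).trans_eq (by simp)
  exact Set.indicator_le_self' (fun _ _ ↦ zero_le_one) y

/-- Chebyshev's inequality for the multiplicity function. -/
theorem mul_volume_le_sum_volume (δ M : ℝ) (𝒞 : Finset PlaneCircle) :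
    ENNReal.ofReal M * volume {y | M < circleMultiplicity δ 𝒞 y} ≤
      ∑ C ∈ 𝒞, volume (C.annulus δ ∩ {y | M < circleMultiplicity δ 𝒞 y}) := by
  set E := {y | M < circleMultiplicity δ 𝒞 y}
  have hE : MeasurableSet E := measurableSet_lt measurable_const (measurable_circleMultiplicity δ 𝒞)
  have hC : ∀ C : PlaneCircle, MeasurableSet (C.annulus δ) := fun C ↦
    (C.isOpen_annulus δ).measurableSet
  rw [← setLIntegral_const]
  simp_rw [← fun C ↦ Measure.restrict_apply (μ := volume) (s := E) (hC C),
    ← fun C ↦ lintegral_indicator_one (μ := volume.restrict E) (hC C)]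
  rw [← lintegral_finsetSum _ fun C _ ↦ measurable_one.indicator (hC C)]
  refine setLIntegral_mono' hE fun y hy ↦ ?_
  refine (ENNReal.ofReal_le_ofReal (le_of_lt hy)).trans_eq ?_
  rw [circleMultiplicity, ENNReal.ofReal_sum_of_nonneg fun C _ ↦
    Set.indicator_nonneg (fun _ _ ↦ zero_le_one) y]
  refine Finset.sum_congr rfl fun C _ ↦ ?_
  by_cases h : y ∈ C.annulus δ <;> simp [h]

theorem PlaneCircle.volume_annulus_ne_top (C : PlaneCircle) (δ : ℝ) :
    volume (C.annulus δ) ≠ ⊤ :=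
  (Metric.isBounded_sphere.thickening.measure_lt_top).ne

/-- The weak-type bound for the multiplicity function, with `n` the cube root of the number of
circles. -/
theorem sum_volume_mul_le {δ M n : ℝ} {𝒞 : Finset PlaneCircle} (h : IsSeparatedFamily δ 𝒞)
    (hne : 𝒞.Nonempty) (hδ : 0 < δ) (hδ' : δ ≤ 1 / 4) (hM : 0 < M) (hn : 0 ≤ n)
    (hcard : n ^ 3 = 𝒞.card) :
    (∑ C ∈ 𝒞, volume.real (C.annulus δ ∩ {y | M < circleMultiplicity δ 𝒞 y})) * M ≤
      512000 * δ * n ^ 5 := by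
  set E := {y | M < circleMultiplicity δ 𝒞 y} with hEdef
  have hE : MeasurableSet E := measurableSet_lt measurable_const (measurable_circleMultiplicity δ 𝒞)
  rcases le_or_gt (𝒞.card : ℝ) M with hMN | hMN
  · have : E = ∅ := by
      ext y
      simpa [hEdef] using (circleMultiplicity_le_card δ 𝒞 y).trans hMN
    simp [this]; positivity
  have hN : (0 : ℝ) < 𝒞.card := by exact_mod_cast hne.card_pos
  set s : PlaneCircle → ℝ := fun C ↦ volume.real (C.annulus δ ∩ E) with hs
  have hfin : ∀ C : PlaneCircle, volume (C.annulus δ ∩ E) ≠ ⊤ := fun C ↦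
    measure_ne_top_of_subset Set.inter_subset_left (C.volume_annulus_ne_top δ)
  set T := ∑ C ∈ 𝒞, s C with hT
  have hT0 : 0 ≤ T := Finset.sum_nonneg fun _ _ ↦ measureReal_nonneg
  have hTsum : ∑ C ∈ 𝒞, volume (C.annulus δ ∩ E) = ENNReal.ofReal T := by
    rw [hT, ENNReal.ofReal_sum_of_nonneg fun _ _ ↦ measureReal_nonneg]
    exact Finset.sum_congr rfl fun C _ ↦ (ofReal_measureReal (hfin C)).symm
  have hcheb := mul_volume_le_sum_volume δ M 𝒞
  rw [← hEdef, hTsum] at hcheb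
  have hEfin : volume E ≠ ⊤ := fun htop ↦ by
    rw [htop, ENNReal.mul_top (by simpa using hM)] at hcheb
    simp at hcheb
  set e := volume.real E
  have he0 : 0 ≤ e := measureReal_nonneg
  have hMe : M * e ≤ T := by
    rw [← ofReal_measureReal hEfin, ← ENNReal.ofReal_mul hM.le] at hcheb
    exact (ENNReal.ofReal_le_ofReal_iff hT0).1 hcheb
  have hnδ : n * δ ≤ 20 := by
    have := h.card_le hδ hδ'
    rw [← hcard, ← mul_pow] at this
    exact le_of_pow_le_pow_left₀ (n := 3) (by norm_num) (by norm_num) (by linarith)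
  -- Chosen so that a ball of radius `σ` meets an annulus in area at most `64σδ = T/(4N)`; removing
  -- two such balls costs half the average of `s`.
  set σ := T / (256 * 𝒞.card * δ) with hσ
  -- For `σ < 4δ` the triple count is unavailable, but `T` is so small that `M < N` and `nδ ≤ 20`
  -- suffice.
  rcases lt_or_ge σ (4 * δ) with hsmall | hlarge
  · rw [hσ, div_lt_iff₀ (by positivity)] at hsmall
    calc T * M ≤ 4 * δ * (256 * 𝒞.card * δ) * 𝒞.card := by gcongr
      _ = 1024 * δ * n ^ 5 * (n * δ) := by rw [← hcard]; ring
      _ ≤ 1024 * δ * n ^ 5 * 20 := by gcongr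
      _ ≤ 512000 * δ * n ^ 5 := by nlinarith [show 0 ≤ δ * n ^ 5 by positivity]
  have hσ0 : 0 < σ := by linarith
  have hTpos : 0 < T := by
    by_contra! h0
    rw [hσ, le_antisymm h0 hT0, zero_div] at hσ0
    exact lt_irrefl _ hσ0
  set a := T / (4 * 𝒞.card) with ha
  have ha0 : 0 < a := by positivity
  have haσ : 64 * σ * δ = a := by rw [hσ, ha]; field_simp; norm_num
  have htri : ∀ C ∈ 𝒞, ENNReal.ofReal ((max (s C - 2 * a) 0) ^ 3) ≤
      volume (separatedTriples (C.annulus δ ∩ E) σ) := fun C hC ↦ by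
    refine le_trans (le_of_eq ?_) (pow_le_volume_separatedTriples
      (a := ENNReal.ofReal a) ((C.isOpen_annulus δ).measurableSet.inter hE) fun y ↦ ?_)
    · rw [ENNReal.ofReal_pow (le_max_right _ _), ← ofReal_measureReal (hfin C),
        two_mul (ENNReal.ofReal a), ← ENNReal.ofReal_add ha0.le ha0.le, ← two_mul,
        ← ENNReal.ofReal_sub _ (by positivity), ENNReal.ofReal_max]
      simp [hs]
    · rw [← haσ]
      refine le_trans (measure_mono ?_) (C.volume_annulus_inter_ball_le y (h.1 C hC).2.1
        (h.1 C hC).2.2 hδ hδ' hσ0.le)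
      exact Set.inter_subset_inter_left _ Set.inter_subset_left
  have hcount := (Finset.sum_le_sum htri).trans
    (sum_volume_separatedTriples_le h hδ hδ' hlarge hE)
  rw [← ENNReal.ofReal_sum_of_nonneg (fun _ _ ↦ by positivity), ← ofReal_measureReal hEfin,
    ← ENNReal.ofReal_pow he0, ← ENNReal.ofReal_mul (by positivity),
    ENNReal.ofReal_le_ofReal_iff (by positivity)] at hcount
  -- Hölder with exponent `3`; truncation at `0` supplies nonnegativity and only increases the sum,
  -- which stays at least `T/2`.
  have hholder := (pow_sum_div_card_le_sum_pow (s := 𝒞) (f := fun C ↦ max (s C - 2 * a) 0)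
    (fun _ _ ↦ le_max_right _ _) 2).trans hcount
  have hlow : T / 2 ≤ ∑ C ∈ 𝒞, max (s C - 2 * a) 0 := by
    calc T / 2 = ∑ C ∈ 𝒞, (s C - 2 * a) := by
          rw [Finset.sum_sub_distrib, ← hT, Finset.sum_const, nsmul_eq_mul, ha]
          field_simp; norm_num
      _ ≤ _ := Finset.sum_le_sum fun C _ ↦ le_max_left _ _
  have heT : e ≤ T / M := by rw [le_div_iff₀ hM]; linarith
  have hmain : (T / 2) ^ 3 / (𝒞.card : ℝ) ^ 2 ≤ 10 ^ 9 / σ ^ 3 * (T / M) ^ 3 := by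
    refine le_trans ?_ (hholder.trans ?_)
    · norm_num only
      gcongr
    · gcongr
  refine le_of_pow_le_pow_left₀ (n := 3) (by norm_num) (by positivity) ?_
  -- As `σ` is proportional to `T`, the right side no longer depends on `T`.
  have e1 : 10 ^ 9 / σ ^ 3 * (T / M) ^ 3 =
      10 ^ 9 * (256 * 𝒞.card * δ) ^ 3 / M ^ 3 := by
    rw [hσ]; field_simp
  rw [e1, div_le_div_iff₀ (by positivity) (by positivity), ← hcard] at hmain
  calc (T * M) ^ 3 = 8 * ((T / 2) ^ 3 * M ^ 3) := by ring
    _ ≤ 8 * (10 ^ 9 * (256 * n ^ 3 * δ) ^ 3 * (n ^ 3) ^ 2) := by gcongr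
    _ = (512000 * δ * n ^ 5) ^ 3 := by ring

/-! ### Dyadic levels and selection of the subfamily. -/

/-- From `2^J δ³ ≤ 8000 ≤ 2^13` one gets `J log 2 ≤ 13 log 2 + 3|log δ|`; the additive constants are
absorbed since `|log δ| ≥ 100`. -/
theorem IsSeparatedFamily.log_card_le {δ : ℝ} {𝒞 : Finset PlaneCircle}
    (h : IsSeparatedFamily δ 𝒞) (hδ : 0 < δ) (hδ' : δ ≤ 1 / 4) (hne : 𝒞.Nonempty)
    (hlog : 100 ≤ |Real.log δ|) : ((Nat.log 2 𝒞.card : ℕ) : ℝ) + 1 ≤ 7 * |Real.log δ| := by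
  set J := Nat.log 2 𝒞.card
  have hJ : (2 : ℝ) ^ J ≤ 𝒞.card := by
    exact_mod_cast Nat.pow_log_le_self 2 hne.card_pos.ne'
  have h1 : (2 : ℝ) ^ J * δ ^ 3 ≤ 2 ^ 13 :=
    (mul_le_mul_of_nonneg_right hJ (by positivity)).trans ((h.card_le hδ hδ').trans (by norm_num))
  have h2 := Real.log_le_log (by positivity) h1
  rw [Real.log_mul (by positivity) (by positivity), Real.log_pow, Real.log_pow, Real.log_pow] at h2
  have h3 := neg_abs_le (Real.log δ)
  have h4 := Real.log_two_gt_d9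
  have h5 := Real.log_two_lt_d9
  have h6 : (0 : ℝ) ≤ J := Nat.cast_nonneg _
  push_cast at h2
  nlinarith

/-- Markov's inequality on a finite set: at most a third of the members exceed three times the
average. -/
theorem Finset.half_card_lt_card_filter_le {ι : Type*} {s : Finset ι} (hs : s.Nonempty)
    {g : ι → ℝ} (hg : ∀ i ∈ s, 0 ≤ g i) {B : ℝ} (hB : 0 < B) (h : ∑ i ∈ s, g i ≤ B * s.card) :
    (1 / 2 : ℝ) * s.card < (s.filter fun i ↦ g i ≤ 3 * B).card := by
  have hN : (0 : ℝ) < s.card := by exact_mod_cast hs.card_pos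
  have hsplit : ((s.filter fun i ↦ g i ≤ 3 * B).card : ℝ) +
      (s.filter fun i ↦ ¬ g i ≤ 3 * B).card = s.card := by
    exact_mod_cast s.card_filter_add_card_filter_not _
  have h1 : (s.filter fun i ↦ ¬ g i ≤ 3 * B).card * (3 * B) ≤ ∑ i ∈ s, g i := by
    rw [← nsmul_eq_mul]
    refine (Finset.card_nsmul_le_sum _ g _ fun i hi ↦ ?_).trans
      (Finset.sum_le_sum_of_subset_of_nonneg (Finset.filter_subset _ _) fun i hi _ ↦ hg i hi)
    exact (not_le.1 (Finset.mem_filter.1 hi).2).le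
  have h2 : ((s.filter fun i ↦ ¬ g i ≤ 3 * B).card : ℝ) * 3 ≤ s.card := by
    refine le_of_mul_le_mul_right ?_ hB
    linarith
  linarith

theorem mainTheorem4 :
    ∃ δ₀ : ℝ, 0 < δ₀ ∧ ∀ δ : ℝ, 0 < δ → δ < δ₀ →
      ∀ 𝒞 : Finset PlaneCircle, 𝒞.Nonempty → IsSeparatedFamily δ 𝒞 →
        ∃ 𝒜 : Finset PlaneCircle, 𝒜 ⊆ 𝒞 ∧
          (1 / 2 : ℝ) * (𝒞.card : ℝ) < (𝒜.card : ℝ) ∧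
          ∀ C ∈ 𝒜, ∀ lam : ℝ, 0 < lam → lam < 1 →
            volume {y : Plane | y ∈ C.annulus δ ∧
                |Real.log δ| ^ 5 * lam⁻¹ * (𝒞.card : ℝ) ^ (2 / 3 : ℝ) < circleMultiplicity δ 𝒞 y}
              ≤ ENNReal.ofReal lam * volume (C.annulus δ) := by
  -- This makes `|log δ| ≥ 100`, so that `|log δ|⁴ ≥ 10⁸` beats the final constant `21504000`.
  refine ⟨Real.exp (-100), Real.exp_pos _, fun δ hδ hδ₀ 𝒞 hne h ↦ ?_⟩
  have hlogδ : Real.log δ < -100 := (Real.log_lt_iff_lt_exp hδ).2 hδ₀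
  have hL : 100 ≤ |Real.log δ| := by rw [abs_of_neg (by linarith)]; linarith
  have hδ' : δ ≤ 1 / 4 := by
    refine hδ₀.le.trans ?_
    rw [Real.exp_neg, one_div]
    exact inv_anti₀ (by norm_num) (by linarith [Real.add_one_le_exp (100 : ℝ)])
  have hN1 : (1 : ℝ) ≤ 𝒞.card := by exact_mod_cast hne.card_pos
  set n : ℝ := (𝒞.card : ℝ) ^ (1 / 3 : ℝ) with hn
  have hn1 : 1 ≤ n := Real.one_le_rpow hN1 (by norm_num)
  have hcard : n ^ 3 = 𝒞.card := by
    rw [hn, ← Real.rpow_natCast, ← Real.rpow_mul (by positivity)]; norm_num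
  have hn2 : (𝒞.card : ℝ) ^ (2 / 3 : ℝ) = n ^ 2 := by
    rw [hn, ← Real.rpow_natCast, ← Real.rpow_mul (by positivity)]; norm_num
  set J := Nat.log 2 𝒞.card with hJ
  have hJL : (J : ℝ) + 1 ≤ 7 * |Real.log δ| := h.log_card_le hδ hδ' hne hL
  set L := |Real.log δ| with hLdef
  let S : PlaneCircle → ℝ → ℝ := fun C M ↦
    volume.real (C.annulus δ ∩ {y | M < circleMultiplicity δ 𝒞 y})
  have hS0 : ∀ C M, 0 ≤ S C M := fun _ _ ↦ measureReal_nonneg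
  -- All levels are put into one sum, so a single use of Markov's inequality controls each of them,
  -- at the cost of a factor `J + 1`.
  let g : PlaneCircle → ℝ := fun C ↦ ∑ j ∈ Finset.range (J + 1), S C (2 ^ j) * 2 ^ j
  have hg : ∑ C ∈ 𝒞, g C ≤ (512000 * δ * n ^ 2 * (J + 1)) * 𝒞.card := by
    calc ∑ C ∈ 𝒞, g C = ∑ j ∈ Finset.range (J + 1), (∑ C ∈ 𝒞, S C (2 ^ j)) * 2 ^ j := by
          rw [Finset.sum_comm]; simp_rw [Finset.sum_mul]
      _ ≤ ∑ j ∈ Finset.range (J + 1), 512000 * δ * n ^ 5 := Finset.sum_le_sum fun j _ ↦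
          sum_volume_mul_le h hne hδ hδ' (by positivity) (by positivity) hcard
      _ = (512000 * δ * n ^ 2 * (J + 1)) * 𝒞.card := by
          rw [Finset.sum_const, Finset.card_range, nsmul_eq_mul, ← hcard]; push_cast; ring
  refine ⟨𝒞.filter fun C ↦ g C ≤ 3 * (512000 * δ * n ^ 2 * (J + 1)), Finset.filter_subset _ _,
    Finset.half_card_lt_card_filter_le hne
      (fun C _ ↦ Finset.sum_nonneg fun j _ ↦ mul_nonneg (hS0 _ _) (by positivity))
      (by positivity) hg, fun C hC lam hlam hlam1 ↦ ?_⟩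
  obtain ⟨hC𝒞, hgC⟩ := Finset.mem_filter.1 hC
  rw [hn2]
  set M := L ^ 5 * lam⁻¹ * n ^ 2 with hM
  have hMpos : 0 < M := by positivity
  change volume (C.annulus δ ∩ {y | M < circleMultiplicity δ 𝒞 y}) ≤ _
  rcases le_or_gt (𝒞.card : ℝ) M with hMN | hMN
  · have : {y | M < circleMultiplicity δ 𝒞 y} = ∅ := by
      ext y
      simpa using (circleMultiplicity_le_card δ 𝒞 y).trans hMN
    simp [this]
  have hM1 : 1 ≤ M := by
    have h1 : 1 ≤ L ^ 5 := one_le_pow₀ (by linarith)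
    have h2 : 1 ≤ lam⁻¹ := (one_le_inv₀ hlam).2 hlam1.le
    have h3 : 1 ≤ n ^ 2 := one_le_pow₀ hn1
    exact one_le_mul_of_one_le_of_one_le (one_le_mul_of_one_le_of_one_le h1 h2) h3
  obtain ⟨j, hj1, hj2⟩ := exists_nat_pow_near hM1 (one_lt_two (α := ℝ))
  have hjJ : j ∈ Finset.range (J + 1) := by
    rw [Finset.mem_range, Nat.lt_succ_iff]
    refine Nat.le_log_of_pow_le one_lt_two ?_
    exact_mod_cast hj1.trans hMN.le
  have hfin : ∀ M', volume (C.annulus δ ∩ {y | M' < circleMultiplicity δ 𝒞 y}) ≠ ⊤ := fun _ ↦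
    measure_ne_top_of_subset Set.inter_subset_left (C.volume_annulus_ne_top δ)
  have hmono : S C M ≤ S C (2 ^ j) :=
    measureReal_mono (Set.inter_subset_inter_right _ fun y hy ↦ lt_of_le_of_lt hj1 hy) (hfin _)
  have hSg : S C (2 ^ j) * 2 ^ j ≤ g C :=
    Finset.single_le_sum (f := fun j ↦ S C (2 ^ j) * (2 : ℝ) ^ j)
      (fun i _ ↦ mul_nonneg (hS0 _ _) (by positivity)) hjJ
  have hSM : S C M * M ≤ lam * δ * M := by
    calc S C M * M ≤ S C (2 ^ j) * 2 ^ (j + 1) := by gcongr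
      _ = 2 * (S C (2 ^ j) * 2 ^ j) := by ring
      _ ≤ 2 * (3 * (512000 * δ * n ^ 2 * (J + 1))) := by linarith [hSg.trans hgC]
      _ ≤ 2 * (3 * (512000 * δ * n ^ 2 * (7 * L))) := by gcongr
      _ = 21504000 * L * (δ * n ^ 2) := by ring
      -- Four of the five logarithms absorb the constant; the fifth pays for the number of levels.
      _ ≤ L ^ 5 * (δ * n ^ 2) := by
          gcongr
          calc 21504000 * L ≤ 100 ^ 4 * L := by gcongr; norm_num
            _ ≤ L ^ 4 * L := by gcongr
            _ = L ^ 5 := by ring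
      _ = lam * δ * M := by rw [hM]; field_simp
  have hfinal : S C M ≤ lam * δ := le_of_mul_le_mul_right hSM hMpos
  calc volume (C.annulus δ ∩ {y | M < circleMultiplicity δ 𝒞 y}) = ENNReal.ofReal (S C M) :=
        (ofReal_measureReal (hfin M)).symm
    _ ≤ ENNReal.ofReal (lam * δ) := ENNReal.ofReal_le_ofReal hfinal
    _ = ENNReal.ofReal lam * ENNReal.ofReal δ := ENNReal.ofReal_mul hlam.le
    _ ≤ ENNReal.ofReal lam * volume (C.annulus δ) := by
        gcongr
        exact PlaneCircle.ofReal_le_volume_annulus (h.1 C hC𝒞).2.1 hδ
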